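/- For a lattice polytope $\mathcal P\subset\mathbb R^N$ of dimension $d$, let $\delta(\mathcal P)=(\delta_0,\dots,\delta_d)$ be its $\delta$-vector ($h^*$-vector), defined by $$(1-t)^{d+1}\Bigl(1+\sum_{n\ge 1}|n\mathcal P\cap\mathbb Z^N|\,t^n\Bigr)=\sum_{i=0}^d\delta_i t^i .$$ A sequence $(a_0,\dots,a_d)$ is log-concave if $a_i^2\ge a_{i-1}a_{i+1}$ for $1\le i\le d-1$, and alternatingly increasing if $a_i\le a_{d-i}$ for $0\le i\le\lfloor (d-1)/2\rfloor$ and $a_{d+1-i}\le a_i$ for $1\le i\le\lfloor d/2\rfloor$. Let $d\ge 4$ and $m\ge 1$ be integers, let $\mathbf e_1,\dots,\mathbf e_d$ be the unit coordinate vectors of $\mathbb R^d$, put $M=(\lceil (d+1)/2\rceil m+1)\lceil (d+2)/2\rceil$, and let $\mathcal P(d,m)\subset\mathbb R^d$ be the convex hull of $v_0,\dots,v_d$, where $v_0=\mathbf 0$, $v_i=\mathbf e_i$ for $1\le i\le d-1$, and $$v_d=(M-\lceil (d+2)/2\rceil m)(\mathbf e_1+\dots+\mathbf e_{\lfloor d/2\rfloor})+(M-1)(\mathbf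 e_{\lfloor d/2\rfloor+1}+\dots+\mathbf e_{d-1})+M\mathbf e_d .$$ Then $\mathcal P(d,m)$ is a lattice simplex of dimension $d$ with vertices $v_0,\dots,v_d$, and its $\delta$-vector $(\delta_0,\dots,\delta_d)$ is as follows. - If $d$ is odd and $d'=(d+1)/2$, then $\delta_i=im+1$ for $0\le i\le d'-1$, $\delta_{d'}=2d'm+1$, and $\delta_i=(d+1-i)m$ for $d'+1\le i\le d$; that is, $$\delta(\mathcal P(d,m))=(1,\,m+1,\,2m+1,\,\dots,\,(d'-1)m+1,\,2d'm+1,\,(d'-1)m,\,\dots,\,m).$$ - If $d$ is even and $d'=d/2$, then $\delta_i=im+1$ for $0\le i\le d'-1$, $\delta_{d'}=(2d'+1)m+1$, and $\delta_i=(d+1-i)m$ for $d'+1\le i\le d$; that is, $$\delta(\mathcal P(d,m))=(1,\,m+1,\,2m+1,\,\dots,\,(d'-1)m+1,\,(2d'+1)m+1,\,d'm,\,(d'-1)m,\,\dots,\,m).$$ In both cases this $\delta$-vector is alternatingly increasing but not log-concave. -/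

import Mathlib

open scoped Pointwise

noncomputable section

/-- The number of lattice points `x ∈ ℤ^N` in the dilate `n • P` of `P ⊆ ℝ^N`. For `n = 0` and
`P` nonempty this is `1`. -/
def latticePointCount {N : ℕ} (P : Set (Fin N → ℝ)) (n : ℕ) : ℕ :=
  Set.ncard {x : Fin N → ℤ | (fun k => (x k : ℝ)) ∈ (n : ℝ) • P}

/-- The dimension of (the affine span of) `P ⊆ ℝ^N`. -/
def polytopeDim {N : ℕ} (P : Set (Fin N → ℝ)) : ℕ :=
  Module.finrank ℝ (vectorSpan ℝ P)

/-- The Ehrhart series `1 + ∑_{n ≥ 1} |nP ∩ ℤ^N| t^n` of a polytope `P ⊆ ℝ^N`. -/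
def ehrhartSeries {N : ℕ} (P : Set (Fin N → ℝ)) : PowerSeries ℤ :=
  PowerSeries.mk fun n => (latticePointCount P n : ℤ)

/-- The entries `δ_i` of the `δ`-vector (`h^*`-vector) of a polytope `P` of dimension `d`: the
coefficients of `(1 - t)^(d + 1) * (1 + ∑_{n ≥ 1} |nP ∩ ℤ^N| t^n)`. -/
def deltaVector {N : ℕ} (P : Set (Fin N → ℝ)) (i : ℕ) : ℤ :=
  PowerSeries.coeff i ((1 - PowerSeries.X) ^ (polytopeDim P + 1) * ehrhartSeries P)

end

/-- Log-concavity of the finite sequence `(a_0, …, a_d)`. -/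
def IsLogConcaveSeq {R : Type*} [Monoid R] [LE R] (d : ℕ) (a : ℕ → R) : Prop :=
  ∀ i : ℕ, 1 ≤ i → i ≤ d - 1 → a (i - 1) * a (i + 1) ≤ a i ^ 2

/-- The finite sequence `(a_0, …, a_d)` is alternatingly increasing:
`a_0 ≤ a_d ≤ a_1 ≤ a_{d-1} ≤ ⋯`. -/
def IsAlternatinglyIncreasing {R : Type*} [LE R] (d : ℕ) (a : ℕ → R) : Prop :=
  (∀ i : ℕ, i ≤ (d - 1) / 2 → a i ≤ a (d - i)) ∧
    ∀ i : ℕ, 1 ≤ i → i ≤ d / 2 → a (d + 1 - i) ≤ a i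

/-- `M = (⌈(d+1)/2⌉ m + 1) ⌈(d+2)/2⌉`. -/
def simplexM (d m : ℕ) : ℕ :=
  (((d + 1) ⌈/⌉ 2) * m + 1) * ((d + 2) ⌈/⌉ 2)

/-- The unit coordinate vector `e_j` of `ℤ^d`, for `1 ≤ j ≤ d`. The coordinate numbered `j` is the
one at the index `k : Fin d` with `k + 1 = j`. -/
def unitVec (d j : ℕ) : Fin d → ℤ :=
  fun k => if (k : ℕ) + 1 = j then 1 else 0

/-- The vertices `v_0, …, v_d` of `P(d, m)`: `v_0 = 0`, `v_i = e_i` for `1 ≤ i ≤ d - 1`, and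
`v_d = (M - ⌈(d+2)/2⌉ m)(e_1 + ⋯ + e_{⌊d/2⌋}) + (M - 1)(e_{⌊d/2⌋+1} + ⋯ + e_{d-1}) + M e_d`. -/
def simplexVertex (d m : ℕ) (i : Fin (d + 1)) : Fin d → ℤ :=
  if (i : ℕ) = 0 then 0
  else if (i : ℕ) < d then unitVec d i
  else
    ((simplexM d m : ℤ) - (((d + 2) ⌈/⌉ 2 : ℕ) : ℤ) * (m : ℤ)) •
        ∑ j ∈ Finset.Icc 1 (d / 2), unitVec d j
      + ((simplexM d m : ℤ) - 1) • ∑ j ∈ Finset.Icc (d / 2 + 1) (d - 1), unitVec d j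
      + (simplexM d m : ℤ) • unitVec d d

/-- The vertex `v_i` of `P(d, m)` as a point of `ℝ^d`. -/
def simplexVertexReal (d m : ℕ) (i : Fin (d + 1)) : Fin d → ℝ :=
  fun k => (simplexVertex d m i k : ℝ)

/-- The lattice simplex `P(d, m)`, the convex hull of `v_0, …, v_d` in `ℝ^d`. -/
def latticeSimplex (d m : ℕ) : Set (Fin d → ℝ) :=
  convexHull ℝ (Set.range (simplexVertexReal d m))

/-! The δ-vector of the lattice simplices P(d, m), computed from the heights of the lattice points
of the fundamental parallelepiped. -/

/-! ### Lattice points in dilates of a simplex -/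

/-! The cone over a lattice simplex is the disjoint union of translates of the monoid generated by
the lifted vertices, one for each lattice point of the half-open fundamental parallelepiped. Hence
δ_i counts the parallelepiped points of height i. For vertices 0, unit vectors and (M - w_1, …, M -
w_e, M), these points are indexed by the last coordinate j < M. Their barycentric coordinates at the
nonzero vertices are j/M and (w_k j mod M)/M, and the coordinate at 0 rounds the sum up to an
integer (`boxHeight`, `deltaVector_hermiteSimplex`).

For P(d, m) put h = ⌊d/2⌋, c = h + 1, q = d - h + 1, K = cm + 1, so that M = Kq. The weights are qm
(h times) and 1 (q - 2 times). With u = mj mod K, the relation cm ≡ -1 mod K gives j + cu = Ks, and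
the height is s if s < q and s - 1 otherwise (`boxHeight_blockWeight`). The points j correspond to
pairs (u, r) with r < q and s = ⌈u/m⌉ + r. The value ⌈u/m⌉ is 0 once and each of 1, …, c exactly m
times. For g = ⌈u/m⌉ ≥ 1 the heights run through g, …, q - 1 and then q - 1, …, g + q - 2; the
repeated q - 1 produces the large middle entry. -/

/-- A point lies in the `n`-th dilate of a polytope iff it is a nonnegative combination of the
vertices with total weight `n`. -/
theorem mem_natCast_smul_convexHull_range_iff {ι E : Type*} [Fintype ι] [Nonempty ι]
    [AddCommGroup E] [Module ℝ E] (v : ι → E) (n : ℕ) (x : E) :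
    x ∈ (n : ℝ) • convexHull ℝ (Set.range v) ↔
      ∃ c : ι → ℝ, (∀ i, 0 ≤ c i) ∧ ∑ i, c i = n ∧ ∑ i, c i • v i = x := by
  classical
  constructor
  · rintro ⟨y, hy, rfl⟩
    have hsub : convexHull ℝ (Set.range v) ⊆
        Fintype.linearCombination ℝ v '' stdSimplex ℝ ι := by
      refine convexHull_min ?_ ((convex_stdSimplex ℝ ι).linear_image _)
      rintro _ ⟨i, rfl⟩
      exact ⟨Pi.single i 1, single_mem_stdSimplex ℝ i, by simp⟩
    obtain ⟨c, hc, rfl⟩ := hsub hy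
    refine ⟨fun i => n * c i, fun i => mul_nonneg n.cast_nonneg (hc.1 i), ?_, ?_⟩
    · rw [← Finset.mul_sum, hc.2, mul_one]
    · simp [Fintype.linearCombination_apply, Finset.smul_sum, mul_smul]
  · rintro ⟨c, hc, hsum, rfl⟩
    -- The weights are normalised by dividing by `n`, so `n = 0` is separate: all weights vanish,
    -- and the zero dilate of a nonempty set is the origin.
    rcases Nat.eq_zero_or_pos n with rfl | hn
    · have h0 : ∀ i, c i = 0 := fun i =>
        (Finset.sum_eq_zero_iff_of_nonneg fun i _ => hc i).1 (by simpa using hsum) i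
          (Finset.mem_univ i)
      have hne : (convexHull ℝ (Set.range v)).Nonempty := (Set.range_nonempty v).convexHull
      simp [h0, Set.zero_smul_set hne]
    · have hn' : (n : ℝ) ≠ 0 := by positivity
      refine ⟨∑ i, (c i / n) • v i, ?_, ?_⟩
      · refine (convex_convexHull ℝ _).sum_mem (fun i _ => div_nonneg (hc i) n.cast_nonneg) ?_
          fun i _ => subset_convexHull ℝ _ ⟨i, rfl⟩
        rw [← Finset.sum_div, hsum, div_self hn']
      · simp only [Finset.smul_sum, smul_smul]
        exact Finset.sum_congr rfl fun i _ => by rw [mul_div_cancel₀ _ hn']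

/-- The vertices of the simplex spanned by `0`, the first `e` unit vectors of `ℝ^(e+1)`, and the
vector `(M - w_1, …, M - w_e, M)`. -/
def hermiteVertex {e : ℕ} (M : ℕ) (w : Fin e → ℕ) : Fin (e + 2) → Fin (e + 1) → ℝ :=
  Fin.cons 0 (Fin.snoc (fun k => Pi.single k.castSucc 1)
    (Fin.snoc (fun k => (M : ℝ) - w k) (M : ℝ)))

section hermiteVertex

variable {e : ℕ} (M : ℕ) (w : Fin e → ℕ)

theorem sum_smul_hermiteVertex_last (c : Fin (e + 2) → ℝ) :
    (∑ i, c i • hermiteVertex M w i) (Fin.last e) = c (Fin.last (e + 1)) * M := by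
  rw [Fin.sum_univ_succ, Fin.sum_univ_castSucc, ← Fin.succ_last]
  simp [hermiteVertex, Finset.sum_apply, (Fin.castSucc_lt_last _).ne']

theorem sum_smul_hermiteVertex_castSucc (c : Fin (e + 2) → ℝ) (k : Fin e) :
    (∑ i, c i • hermiteVertex M w i) k.castSucc =
      c k.castSucc.succ + c (Fin.last (e + 1)) * (M - w k) := by
  rw [Fin.sum_univ_succ, Fin.sum_univ_castSucc, ← Fin.succ_last]
  simp [hermiteVertex, Finset.sum_apply, Pi.single_apply]

theorem affineIndependent_hermiteVertex (hM : 0 < M) :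
    AffineIndependent ℝ (hermiteVertex M w) := by
  rw [affineIndependent_iff_of_fintype]
  intro c hc h
  rw [Finset.univ.weightedVSub_eq_linear_combination hc] at h
  have hlast : c (Fin.last e).succ = 0 := by
    have := congrFun h (Fin.last e)
    rw [sum_smul_hermiteVertex_last] at this
    simpa [hM.ne'] using this
  have hmid : ∀ k : Fin e, c k.castSucc.succ = 0 := by
    intro k
    have := congrFun h k.castSucc
    rw [sum_smul_hermiteVertex_castSucc, ← Fin.succ_last, hlast] at this
    simpa using this
  have hzero : c 0 = 0 := by
    rw [Fin.sum_univ_succ, Fin.sum_univ_castSucc] at hc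
    simpa only [hlast, hmid, Finset.sum_const_zero, add_zero] using hc
  intro i
  refine Fin.cases hzero (fun j => ?_) i
  exact Fin.lastCases hlast hmid j

theorem polytopeDim_convexHull_range_of_affineIndependent {N n : ℕ}
    {v : Fin (n + 1) → Fin N → ℝ} (hv : AffineIndependent ℝ v) :
    polytopeDim (convexHull ℝ (Set.range v)) = n := by
  rw [polytopeDim, ← direction_affineSpan, affineSpan_convexHull, direction_affineSpan]
  exact hv.finrank_vectorSpan (by simp)

/-- The integral inequalities describing the lattice points of the dilates of the simplex. -/
theorem intCast_mem_smul_hermiteSimplex_iff (hM : 0 < M) (n : ℕ) (x : Fin (e + 1) → ℤ) :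
    (fun k => (x k : ℝ)) ∈ (n : ℝ) • convexHull ℝ (Set.range (hermiteVertex M w)) ↔
      0 ≤ x (Fin.last e) ∧
      (∀ k : Fin e, 0 ≤ M * (x k.castSucc - x (Fin.last e)) + w k * x (Fin.last e)) ∧
      x (Fin.last e) + ∑ k : Fin e, (M * (x k.castSucc - x (Fin.last e)) + w k * x (Fin.last e))
        ≤ n * M := by
  rw [mem_natCast_smul_convexHull_range_iff]
  have hM' : (0 : ℝ) < M := by exact_mod_cast hM
  constructor
  · rintro ⟨c, hc, hsum, hx⟩
    have hl := congrFun hx (Fin.last e)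
    rw [sum_smul_hermiteVertex_last] at hl
    have hk := fun k : Fin e => congrFun hx k.castSucc
    simp only [sum_smul_hermiteVertex_castSucc] at hk
    have key : ∀ k : Fin e, (M * ((x k.castSucc : ℝ) - x (Fin.last e)) + w k * x (Fin.last e)) =
        M * c k.castSucc.succ := by
      intro k
      rw [← hk, ← hl]; ring
    refine ⟨?_, fun k => ?_, ?_⟩
    · have : (0 : ℝ) ≤ x (Fin.last e) := hl ▸ mul_nonneg (hc _) hM'.le
      exact_mod_cast this
    · have := key k ▸ mul_nonneg hM'.le (hc k.castSucc.succ)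
      exact_mod_cast this
    · have : (x (Fin.last e) : ℝ) + ∑ k : Fin e,
          (M * ((x k.castSucc : ℝ) - x (Fin.last e)) + w k * x (Fin.last e)) ≤ n * M := by
        rw [Finset.sum_congr rfl fun k _ => key k, ← hl, ← Finset.mul_sum, ← hsum,
          Fin.sum_univ_succ, Fin.sum_univ_castSucc, Fin.succ_last]
        nlinarith [mul_nonneg (hc 0) hM'.le]
      exact_mod_cast this
  · rintro ⟨h1, h2, h3⟩
    have h1' : (0 : ℝ) ≤ x (Fin.last e) := by exact_mod_cast h1
    have h2' : ∀ k : Fin e, (0 : ℝ) ≤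
        M * ((x k.castSucc : ℝ) - x (Fin.last e)) + w k * x (Fin.last e) := by
      intro k; exact_mod_cast h2 k
    have h3' : (x (Fin.last e) : ℝ) + ∑ k : Fin e,
          (M * ((x k.castSucc : ℝ) - x (Fin.last e)) + w k * x (Fin.last e)) ≤ n * M := by
      exact_mod_cast h3
    -- Barycentric coordinates at the nonzero vertices; the vertex 0 receives the slack `n - ∑ k, b
    -- k`, which is nonnegative by the last inequality.
    set b : Fin (e + 1) → ℝ := Fin.snoc
      (fun k => (M * ((x k.castSucc : ℝ) - x (Fin.last e)) + w k * x (Fin.last e)) / M)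
      ((x (Fin.last e) : ℝ) / M) with hb
    refine ⟨Fin.cons (n - ∑ k, b k) b, ?_, ?_, ?_⟩
    · refine Fin.cases ?_ (fun j => ?_)
      · simp only [Fin.cons_zero, hb, Fin.sum_univ_castSucc, Fin.snoc_castSucc, Fin.snoc_last]
        rw [← Finset.sum_div, ← add_div, sub_nonneg, div_le_iff₀ hM', add_comm]
        exact h3'
      · rw [Fin.cons_succ]
        refine Fin.lastCases ?_ (fun k => ?_) j
        · simpa [hb] using div_nonneg h1' hM'.le
        · simpa [hb] using div_nonneg (h2' k) hM'.le
    · simp [Fin.sum_univ_succ (n := e + 1)]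
    · ext j
      refine Fin.lastCases ?_ (fun k => ?_) j
      · rw [sum_smul_hermiteVertex_last, ← Fin.succ_last]
        simp [hb, hM'.ne']
      · rw [sum_smul_hermiteVertex_castSucc, ← Fin.succ_last]
        simp only [Fin.cons_succ, hb, Fin.snoc_castSucc, Fin.snoc_last]
        field_simp
        ring

end hermiteVertex

/-! ### The Ehrhart series as a sum over parallelepiped points. -/

section hermiteSeries

variable {e : ℕ} (M : ℕ) (w : Fin e → ℕ)

/-- The height of the `j`-th lattice point of the fundamental parallelepiped of the cone over the
simplex with vertices `hermiteVertex M w`. -/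
def boxHeight (j : ℕ) : ℕ := (j + ∑ k : Fin e, w k * j % M) ⌈/⌉ M

/-- The lattice point with parallelepiped part `p.1` and integral part `p.2`. -/
def boxPoint (p : ℕ × (Fin (e + 2) → ℕ)) : Fin (e + 1) → ℤ :=
  Fin.snoc (fun k => (p.2 k.castSucc.succ : ℤ) + (M * p.2 (Fin.last e).succ + p.1 : ℕ)
      - (w k * (M * p.2 (Fin.last e).succ + p.1) / M : ℕ))
    ((M * p.2 (Fin.last e).succ + p.1 : ℕ) : ℤ)

/-- This facet form is M times the barycentric coordinate at the k-th unit vector. Division by M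
splits it into the integral part `p.2` and a residue depending only on `p.1`. -/
theorem boxPoint_facet (p : ℕ × (Fin (e + 2) → ℕ)) (k : Fin e) :
    M * (boxPoint M w p k.castSucc - boxPoint M w p (Fin.last e)) +
      w k * boxPoint M w p (Fin.last e) = (M * p.2 k.castSucc.succ + w k * p.1 % M : ℕ) := by
  obtain ⟨j, a⟩ := p
  simp only [boxPoint, Fin.snoc_castSucc, Fin.snoc_last]
  have h1 := Nat.div_add_mod (w k * (M * a (Fin.last e).succ + j)) M
  have h2 : w k * (M * a (Fin.last e).succ + j) % M = w k * j % M := by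
    rw [mul_add, mul_left_comm, Nat.mul_add_mod]
  rw [h2] at h1
  generalize w k * (M * a (Fin.last e).succ + j) / M = q at *
  generalize w k * j % M = r at *
  have h3 : (M : ℤ) * q + r = w k * (M * a (Fin.last e).succ + j) := by exact_mod_cast h1
  push_cast
  linear_combination -h3

/-- Each lattice point of the cone is uniquely a parallelepiped point plus a nonnegative integer
combination of lifted vertices. The multiplicity at the vertex 0 is forced by the total height `n`.
-/
theorem ncard_box_eq_latticePointCount (hM : 0 < M) (n : ℕ) :
    latticePointCount (convexHull ℝ (Set.range (hermiteVertex M w))) n =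
      Set.ncard {p : ℕ × (Fin (e + 2) → ℕ) |
        p.1 < M ∧ ∑ i, p.2 i + boxHeight M w p.1 = n} := by
  symm
  unfold latticePointCount
  refine Set.ncard_congr (fun p _ => boxPoint M w p) ?_ ?_ ?_
  · rintro ⟨j, a⟩ ⟨hj, hn⟩
    simp only at hj hn
    rw [Set.mem_ofPred_eq, intCast_mem_smul_hermiteSimplex_iff M w hM]
    simp only [boxPoint_facet]
    refine ⟨by simp only [boxPoint, Fin.snoc_last]; positivity, fun k => by positivity, ?_⟩
    simp only [boxPoint, Fin.snoc_last]
    have hc : j + ∑ k : Fin e, w k * j % M ≤ M * boxHeight M w j :=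
      (ceilDiv_le_iff_le_mul hM).1 le_rfl
    rw [Fin.sum_univ_succ, Fin.sum_univ_castSucc] at hn
    norm_cast
    rw [Finset.sum_add_distrib, ← Finset.mul_sum, ← hn]
    nlinarith [Nat.zero_le (a 0 * M)]
  · rintro ⟨j, a⟩ ⟨j', a'⟩ ⟨hj, hn⟩ ⟨hj', hn'⟩ h
    simp only at hj hn hj' hn' h
    have hl := congrFun h (Fin.last e)
    simp only [boxPoint, Fin.snoc_last, Nat.cast_inj] at hl
    have hjj : j = j' := by
      have := congrArg (· % M) hl
      simpa [Nat.mul_add_mod, Nat.mod_eq_of_lt hj, Nat.mod_eq_of_lt hj'] using this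
    subst hjj
    have hal : a (Fin.last e).succ = a' (Fin.last e).succ :=
      Nat.eq_of_mul_eq_mul_left hM (by omega)
    have hak : ∀ k : Fin e, a k.castSucc.succ = a' k.castSucc.succ := by
      intro k
      have := congrFun h k.castSucc
      simp only [boxPoint, Fin.snoc_castSucc, hal] at this
      omega
    have ha0 : a 0 = a' 0 := by
      rw [Fin.sum_univ_succ, Fin.sum_univ_castSucc] at hn hn'
      rw [Finset.sum_congr rfl fun k _ => hak k, hal] at hn
      omega
    congr 1
    ext i
    refine Fin.cases ha0 (fun i => ?_) i
    exact Fin.lastCases hal hak i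
  · intro x hx
    rw [Set.mem_ofPred_eq, intCast_mem_smul_hermiteSimplex_iff M w hM] at hx
    obtain ⟨h1, h2, h3⟩ := hx
    -- The preimage is found by division with remainder by M: `y % M` names the parallelepiped
    -- point, while `y / M` and `f k / M` are the multiplicities.
    obtain ⟨y, hy⟩ := Int.eq_ofNat_of_zero_le h1
    choose f hf using fun k => Int.eq_ofNat_of_zero_le (h2 k)
    have hfm : ∀ k, f k % M = w k * (y % M) % M := by
      intro k
      have := hf k
      rw [hy] at this
      rw [Nat.mul_mod_mod]
      zify
      rw [← this]
      simp
    have hfd : ∀ k, M * (f k / M) + w k * (y % M) % M = f k := by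
      intro k
      rw [← hfm, Nat.div_add_mod]
    have hh : boxHeight M w (y % M) + (∑ k, f k / M + y / M) ≤ n := by
      have h3' : y + ∑ k, f k ≤ n * M := by
        rw [Finset.sum_congr rfl fun k _ => hf k, hy] at h3
        exact_mod_cast h3
      have hs : M * ∑ k, f k / M + ∑ k, w k * (y % M) % M = ∑ k, f k := by
        rw [Finset.mul_sum, ← Finset.sum_add_distrib]
        exact Finset.sum_congr rfl fun k _ => hfd k
      have hy' := Nat.div_add_mod y M
      have hle : ∑ k, f k / M + y / M ≤ n := by
        refine Nat.le_of_mul_le_mul_left (?_ : M * _ ≤ M * _) hM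
        rw [mul_add, mul_comm M n]
        omega
      -- The slack `t` satisfies `M * t` ≥ (sum of the residues), so it is at least the ceiling
      -- defining `boxHeight`.
      obtain ⟨t, ht⟩ := Nat.exists_eq_add_of_le hle
      have : boxHeight M w (y % M) ≤ t := by
        refine (ceilDiv_le_iff_le_mul hM).2 ?_
        rw [ht] at h3'
        nlinarith
      omega
    refine ⟨(y % M, Fin.cons (n - (boxHeight M w (y % M) + (∑ k, f k / M + y / M)))
      (Fin.snoc (fun k => f k / M) (y / M))), ⟨Nat.mod_lt _ hM, ?_⟩, ?_⟩
    · simp only [Fin.sum_univ_succ (n := e + 1), Fin.cons_zero, Fin.cons_succ,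
        Fin.sum_univ_castSucc, Fin.snoc_castSucc, Fin.snoc_last]
      omega
    · set p : ℕ × (Fin (e + 2) → ℕ) :=
        (y % M, Fin.cons (n - (boxHeight M w (y % M) + (∑ k, f k / M + y / M)))
          (Fin.snoc (fun k => f k / M) (y / M))) with hp
      have hlast : boxPoint M w p (Fin.last e) = x (Fin.last e) := by
        simp only [boxPoint, hp, Fin.cons_succ, Fin.snoc_last, Nat.div_add_mod, hy]
      ext i
      refine Fin.lastCases hlast (fun k => ?_) i
      have := boxPoint_facet M w p k
      have hr : M * p.2 k.castSucc.succ + w k * p.1 % M = f k := by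
        simp only [hp, Fin.cons_succ, Fin.snoc_castSucc]
        exact hfd k
      rw [hr, hlast, ← hf k] at this
      have hM' : (M : ℤ) ≠ 0 := by exact_mod_cast hM.ne'
      have := mul_left_cancel₀ hM' (add_right_cancel this)
      omega

theorem card_piAntidiag_univ_fin (D n : ℕ) :
    ((Finset.univ : Finset (Fin (D + 1))).piAntidiag n).card = (D + n).choose D := by
  classical
  have h := congrArg Finset.card (Finset.map_sym_eq_piAntidiag (Finset.univ : Finset (Fin (D + 1))) n)
  rw [Finset.card_map] at h
  rw [← h, Finset.sym_univ, Finset.card_univ, Sym.card_sym_eq_choose, Fintype.card_fin,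
    show D + 1 + n - 1 = D + n by omega, Nat.choose_symm_add]

theorem latticePointCount_hermiteSimplex (hM : 0 < M) (n : ℕ) :
    latticePointCount (convexHull ℝ (Set.range (hermiteVertex M w))) n =
      ∑ j ∈ Finset.range M, if boxHeight M w j ≤ n then
        (e + 1 + (n - boxHeight M w j)).choose (e + 1) else 0 := by
  classical
  rw [ncard_box_eq_latticePointCount M w hM]
  have : {p : ℕ × (Fin (e + 2) → ℕ) | p.1 < M ∧ ∑ i, p.2 i + boxHeight M w p.1 = n} =
      ((Finset.range M).sigma fun j => if boxHeight M w j ≤ n then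
        (Finset.univ : Finset (Fin (e + 2))).piAntidiag (n - boxHeight M w j) else ∅).map
        (Equiv.sigmaEquivProd ℕ (Fin (e + 2) → ℕ)).toEmbedding := by
    ext ⟨j, a⟩
    simp only [Set.mem_ofPred_eq, Finset.coe_map, Set.mem_image, Finset.mem_coe, Finset.mem_sigma,
      Finset.mem_range]
    constructor
    · rintro ⟨hj, hn⟩
      refine ⟨⟨j, a⟩, ⟨hj, ?_⟩, rfl⟩
      dsimp only
      rw [if_pos (by omega)]
      simp only [Finset.mem_piAntidiag, Finset.mem_univ, implies_true, and_true]
      exact Nat.eq_sub_of_add_eq hn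
    · rintro ⟨⟨j', a'⟩, ⟨hj, ha⟩, h⟩
      obtain ⟨rfl, rfl⟩ : j' = j ∧ a' = a := by simpa using h
      refine ⟨hj, ?_⟩
      dsimp only at ha ⊢
      split_ifs at ha with hle
      · simp only [Finset.mem_piAntidiag, Finset.mem_univ, implies_true, and_true] at ha
        have ha' : ∑ i, a' i = n - boxHeight M w j' := ha
        omega
      · simp at ha
  rw [this, Set.ncard_coe_finset, Finset.card_map, Finset.card_sigma]
  refine Finset.sum_congr rfl fun j _ => ?_
  split_ifs
  · exact card_piAntidiag_univ_fin (e + 1) _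
  · rfl

open PowerSeries in
theorem one_sub_X_pow_mul_ehrhartSeries_hermiteSimplex (hM : 0 < M) :
    (1 - X) ^ (e + 2) * ehrhartSeries (convexHull ℝ (Set.range (hermiteVertex M w))) =
      ∑ j ∈ Finset.range M, (X : PowerSeries ℤ) ^ boxHeight M w j := by
  have hs : ehrhartSeries (convexHull ℝ (Set.range (hermiteVertex M w))) =
      (∑ j ∈ Finset.range M, (X : PowerSeries ℤ) ^ boxHeight M w j) *
        (invOneSubPow ℤ (e + 2)).val := by
    ext n
    rw [ehrhartSeries, coeff_mk, latticePointCount_hermiteSimplex M w hM, Finset.sum_mul, map_sum,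
      Nat.cast_sum]
    refine Finset.sum_congr rfl fun j _ => ?_
    rw [coeff_X_pow_mul', invOneSubPow_val_succ_eq_mk_add_choose, coeff_mk]
    split_ifs <;> simp
  rw [hs, mul_left_comm, ← invOneSubPow_inv_eq_one_sub_pow, (invOneSubPow ℤ (e + 2)).inv_val,
    mul_one]

theorem deltaVector_hermiteSimplex (hM : 0 < M) (i : ℕ) :
    deltaVector (convexHull ℝ (Set.range (hermiteVertex M w))) i =
      ∑ j ∈ Finset.range M, if boxHeight M w j = i then 1 else 0 := by
  rw [deltaVector, polytopeDim_convexHull_range_of_affineIndependent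
    (affineIndependent_hermiteVertex M w hM), one_sub_X_pow_mul_ehrhartSeries_hermiteSimplex M w hM,
    map_sum]
  exact Finset.sum_congr rfl fun j _ => by rw [PowerSeries.coeff_X_pow]; simp only [eq_comm]

end hermiteSeries

/-! ### Heights of the points of the fundamental parallelepiped -/

theorem Nat.ceilDiv_eq_of_add_eq {a b t x : ℕ} (h : a + x = b * t) (hx : x < b) :
    a ⌈/⌉ b = t := by
  rw [Nat.ceilDiv_eq_add_pred_div]
  refine Nat.div_eq_of_lt_le ?_ ?_
  · rw [mul_comm]; omega
  · rw [add_mul, one_mul, mul_comm]; omega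

/-- The weights of the coordinates of `P(d, m)`. -/
def blockWeight (e h q m : ℕ) (k : Fin e) : ℕ := if (k : ℕ) < h then q * m else 1

theorem sum_blockWeight_mul_mod {e h q m K j : ℕ} (he : e + 2 = h + q) (hq : 2 ≤ q)
    (hj : j < K * q) :
    ∑ k : Fin e, blockWeight e h q m k * j % (K * q) = h * (q * (m * j % K)) + (q - 2) * j := by
  obtain ⟨l, rfl⟩ : ∃ l, q = l + 2 := ⟨q - 2, by omega⟩
  obtain rfl : e = h + l := by omega
  rw [Fin.sum_univ_add]
  simp only [blockWeight, Fin.val_castAdd, Fin.is_lt, if_true, Fin.val_natAdd,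
    Nat.not_lt.2 (Nat.le_add_right _ _), if_false, one_mul, Nat.mod_eq_of_lt hj, Finset.sum_const,
    Finset.card_univ, Fintype.card_fin, smul_eq_mul, Nat.add_sub_cancel]
  rw [mul_comm K (l + 2), mul_assoc (l + 2) m j, Nat.mul_mod_mul_left]

/-- Modulo cm + 1 the inverse of m is -c, so j ≡ -cu is the same as mj ≡ u. -/
theorem mul_mod_of_add_mul_eq {c m j u s : ℕ} (hu : u < c * m + 1)
    (h : j + c * u = (c * m + 1) * s) : m * j % (c * m + 1) = u := by
  have h1 : m * j + (c * m + 1) * u = u + (c * m + 1) * (m * s) := by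
    calc m * j + (c * m + 1) * u = m * (j + c * u) + u := by ring
      _ = u + (c * m + 1) * (m * s) := by rw [h]; ring
  have h2 := congrArg (· % (c * m + 1)) h1
  simpa [Nat.add_mul_mod_self_left, Nat.mod_eq_of_lt hu] using h2

/-- With t = q - c ∈ {0, 1}, eliminating j turns the numerator (q - 1)j + hqu into Kqs - (Ks + tu).
Since tu < K, the subtracted term is below Kq when s < q, and lies in [Kq, 2Kq) when q ≤ s < c + q.
-/
theorem boxHeight_blockWeight {e h q m c j u s : ℕ} (he : e + 2 = h + q) (hc : c = h + 1)
    (hq : 2 ≤ q) (hcq : c ≤ q) (hqc : q ≤ c + 1) (hu : u < c * m + 1) (hs : s < c + q)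
    (hj : j < (c * m + 1) * q) (hjs : j + c * u = (c * m + 1) * s) :
    boxHeight ((c * m + 1) * q) (blockWeight e h q m) j = if s < q then s else s - 1 := by
  rw [boxHeight, sum_blockWeight_mul_mod he hq hj, mul_mod_of_add_mul_eq hu hjs]
  obtain ⟨t, rfl⟩ := Nat.exists_eq_add_of_le hcq
  set K := c * m + 1 with hK
  have ht : t ≤ 1 := by omega
  have htu : t * u ≤ t * K := Nat.mul_le_mul_left _ hu.le
  have hN : j + (h * ((c + t) * u) + (c + t - 2) * j) + (K * s + t * u) = K * (c + t) * s := by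
    obtain ⟨l, hl⟩ : ∃ l, c + t = l + 2 := ⟨c + t - 2, by omega⟩
    rw [hl, Nat.add_sub_cancel]
    zify at hc hl hjs ⊢
    have hh : (h : ℤ) = c - 1 := by linarith
    have ht' : (t : ℤ) = l + 2 - c := by linarith
    rw [hh, ht']
    linear_combination ((l : ℤ) + 1) * hjs
  split_ifs with hsq
  · refine Nat.ceilDiv_eq_of_add_eq hN ?_
    have h1 : K * (s + 1) ≤ K * (c + t) := Nat.mul_le_mul_left _ hsq
    interval_cases t <;> simp only [zero_mul, one_mul] at * <;> linarith
  · obtain ⟨y, rfl⟩ : ∃ y, s = c + t + y := ⟨s - (c + t), by omega⟩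
    refine Nat.ceilDiv_eq_of_add_eq (x := K * y + t * u) ?_ ?_
    · obtain ⟨z, hz⟩ : ∃ z, c + t + y = z + 1 := ⟨c + t + y - 1, by omega⟩
      rw [hz, Nat.add_sub_cancel]
      have hz' : K * (c + t) * z + K * (c + t) = K * (c + t) * (c + t + y) := by rw [hz]; ring
      nlinarith
    · have h1 : K * (y + 1) ≤ K * c := Nat.mul_le_mul_left _ (by omega)
      have h2 : 0 < K := by omega
      nlinarith

/-- For u ≤ cm, ⌈u/m⌉ is also ⌈cu/(cm + 1)⌉, the least s with (cm + 1)s - cu ≥ 0. This is where the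
range of s for a given u begins. -/
theorem mul_ceilDiv_bounds {c m u : ℕ} (hm : 0 < m) (hu : u < c * m + 1) :
    u ⌈/⌉ m ≤ c ∧ c * u ≤ (c * m + 1) * (u ⌈/⌉ m) ∧
      (c * m + 1) * (u ⌈/⌉ m) < c * u + (c * m + 1) := by
  have h1 : u ⌈/⌉ m ≤ c := (ceilDiv_le_iff_le_mul hm).2 (by rw [mul_comm]; omega)
  have h2 : u ≤ m * (u ⌈/⌉ m) := (ceilDiv_le_iff_le_mul hm).1 le_rfl
  refine ⟨h1, by nlinarith, ?_⟩
  rcases hg : u ⌈/⌉ m with _ | g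
  · simp
  · have h3 : m * g < u := by
      by_contra hcon
      have := (ceilDiv_le_iff_le_mul hm).2 (not_lt.1 hcon)
      omega
    have h4 : c * (m * g + 1) ≤ c * u := Nat.mul_le_mul_left _ h3
    nlinarith

theorem sum_boxHeight_blockWeight {e h q m c : ℕ} (he : e + 2 = h + q) (hc : c = h + 1)
    (hq : 2 ≤ q) (hcq : c ≤ q) (hqc : q ≤ c + 1) (hm : 0 < m) (f : ℕ → ℕ) :
    ∑ j ∈ Finset.range ((c * m + 1) * q),
        f (boxHeight ((c * m + 1) * q) (blockWeight e h q m) j) =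
      ∑ u ∈ Finset.range (c * m + 1), ∑ r ∈ Finset.range q,
        f (if u ⌈/⌉ m + r < q then u ⌈/⌉ m + r else u ⌈/⌉ m + r - 1) := by
  set F : ℕ × ℕ → ℕ := fun p => (c * m + 1) * (p.1 ⌈/⌉ m + p.2) - c * p.1 with hF
  have hadd : ∀ p : ℕ × ℕ, p.1 < c * m + 1 →
      F p + c * p.1 = (c * m + 1) * (p.1 ⌈/⌉ m + p.2) := by
    intro p hp
    have := (mul_ceilDiv_bounds hm hp).2.1
    rw [hF]
    refine Nat.sub_add_cancel (this.trans ?_)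
    exact Nat.mul_le_mul_left _ (Nat.le_add_right _ _)
  have hlt : ∀ p : ℕ × ℕ, p.1 < c * m + 1 → p.2 < q → F p < (c * m + 1) * q := by
    intro p hp hp'
    have h1 := hadd p hp
    have h2 := (mul_ceilDiv_bounds hm hp).2.2
    have h3 : (c * m + 1) * (p.2 + 1) ≤ (c * m + 1) * q := Nat.mul_le_mul_left _ hp'
    rw [mul_add] at h1 h3
    omega
  have hmaps : Set.MapsTo F (Finset.range (c * m + 1) ×ˢ Finset.range q : Finset (ℕ × ℕ))
      (Finset.range ((c * m + 1) * q)) := by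
    intro p hp
    simp only [Finset.coe_product, Set.mem_prod, Finset.mem_coe, Finset.mem_range] at hp ⊢
    exact hlt p hp.1 hp.2
  have hinj : Set.InjOn F (Finset.range (c * m + 1) ×ˢ Finset.range q : Finset (ℕ × ℕ)) := by
    rintro ⟨u, r⟩ hp ⟨u', r'⟩ hp' h
    simp only [Finset.coe_product, Set.mem_prod, Finset.mem_coe, Finset.mem_range] at hp hp'
    have h1 := hadd (u, r) hp.1
    have h2 := hadd (u', r') hp'.1
    have h3 := mul_mod_of_add_mul_eq hp.1 h1
    rw [h, mul_mod_of_add_mul_eq hp'.1 h2] at h3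
    subst h3
    rw [← h, h1] at h2
    have := Nat.eq_of_mul_eq_mul_left (Nat.succ_pos _) h2
    simp only [Nat.add_left_cancel_iff] at this
    rw [this]
  rw [← Finset.sum_product']
  symm
  refine Finset.sum_nbij F hmaps hinj ?_ ?_
  -- Both sides have K · q elements, so injectivity suffices.
  · exact Finset.surjOn_of_injOn_of_card_le F hmaps hinj (by simp)
  · rintro ⟨u, r⟩ hp
    simp only [Finset.mem_product, Finset.mem_range] at hp
    rw [boxHeight_blockWeight he hc hq hcq hqc hp.1 _ (hlt _ hp.1 hp.2) (hadd _ hp.1)]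
    have := (mul_ceilDiv_bounds hm hp.1).1
    simp only
    omega

theorem sum_range_ceilDiv (m c : ℕ) (F : ℕ → ℕ) :
    ∑ u ∈ Finset.range (c * m + 1), F (u ⌈/⌉ m) = F 0 + m * ∑ g ∈ Finset.range c, F (g + 1) := by
  induction c with
  | zero => simp
  | succ c ih =>
    rw [show (c + 1) * m + 1 = c * m + 1 + m by ring, Finset.sum_range_add, ih,
      Finset.sum_range_succ (fun g => F (g + 1)), mul_add, add_assoc]
    congr 2
    have : ∀ v ∈ Finset.range m, F ((c * m + 1 + v) ⌈/⌉ m) = F (c + 1) := by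
      intro v hv
      rw [Finset.mem_range] at hv
      rw [Nat.ceilDiv_eq_of_add_eq (t := c + 1) (x := m - 1 - v)]
      · rw [mul_add, mul_one, mul_comm m c]; omega
      · omega
    rw [Finset.sum_congr rfl this]
    simp

/-- The first summand counts pairs with s < q, the second those with s ≥ q together with the loss of
one in height; both are nonzero at i = q - 1. -/
theorem sum_boxHeight_blockWeight_eq {e h q m c : ℕ} (he : e + 2 = h + q) (hc : c = h + 1)
    (hq : 2 ≤ q) (hcq : c ≤ q) (hqc : q ≤ c + 1) (hm : 0 < m) (i : ℕ) :
    ∑ j ∈ Finset.range ((c * m + 1) * q),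
        (if boxHeight ((c * m + 1) * q) (blockWeight e h q m) j = i then 1 else 0) =
      (if i < q then i * m + 1 else 0) + (if q ≤ i + 1 then (c + q - 1 - i) * m else 0) := by
  rw [sum_boxHeight_blockWeight he hc hq hcq hqc hm fun x => if x = i then 1 else 0,
    sum_range_ceilDiv m c fun g => ∑ r ∈ Finset.range q,
      if (if g + r < q then g + r else g + r - 1) = i then 1 else 0]
  have h0 : ∑ r ∈ Finset.range q, (if (if 0 + r < q then 0 + r else 0 + r - 1) = i then 1 else 0) =
      if i < q then 1 else 0 := by
    rw [Finset.sum_congr rfl (g := fun r => if r = i then 1 else 0)]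
    · simp
    · intro r hr
      rw [Finset.mem_range] at hr
      simp [hr]
  have h1 : ∀ g ∈ Finset.range c, ∑ r ∈ Finset.range q,
      (if (if g + 1 + r < q then g + 1 + r else g + 1 + r - 1) = i then 1 else 0) =
        (if i < q then (if g < i then 1 else 0) else 0) +
          (if q ≤ i + 1 then (if i < g + q then 1 else 0) else 0) := by
    intro g hg
    rw [Finset.mem_range] at hg
    -- Each branch attains height `i` for at most one `r`: s = i gives `i - (g + 1)`, and s = i + 1
    -- gives `i - g`. The guards exclude truncated subtraction; in the second case `q ≤ i + 1`
    -- forces `g ≤ i` because g < c ≤ q.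
    rw [Finset.sum_congr rfl (g := fun r => (if r = i - (g + 1) then
        (if i < q ∧ g < i then 1 else 0) else 0) +
        (if r = i - g then (if q ≤ i + 1 then 1 else 0) else 0))]
    · rw [Finset.sum_add_distrib, Finset.sum_ite_eq', Finset.sum_ite_eq']
      simp only [Finset.mem_range]
      split_ifs <;> omega
    · intro r hr
      rw [Finset.mem_range] at hr
      split_ifs <;> omega
  rw [h0, Finset.sum_congr rfl h1, Finset.sum_add_distrib]
  have h2 : ∑ g ∈ Finset.range c, (if i < q then (if g < i then 1 else 0) else 0) =
      if i < q then i else 0 := by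
    split_ifs with hi
    · rw [Finset.sum_boole, show (Finset.range c).filter (· < i) = Finset.range i by
        ext g; simp only [Finset.mem_filter, Finset.mem_range]; omega]
      simp
    · simp
  have h3 : ∑ g ∈ Finset.range c, (if q ≤ i + 1 then (if i < g + q then 1 else 0) else 0) =
      if q ≤ i + 1 then c + q - 1 - i else 0 := by
    split_ifs with hi
    · rw [Finset.sum_boole, show (Finset.range c).filter (i < · + q) = Finset.Ico (i + 1 - q) c by
        ext g; simp only [Finset.mem_filter, Finset.mem_range, Finset.mem_Ico]; omega]
      simp only [Nat.card_Ico, Nat.cast_id]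
      omega
    · simp
  rw [h2, h3]
  split_ifs <;> ring

/-! ### The simplex `P(d, m)` -/

theorem sum_unitVec_apply {d : ℕ} (s : Finset ℕ) (k : Fin d) :
    (∑ j ∈ s, unitVec d j) k = if (k : ℕ) + 1 ∈ s then 1 else 0 := by
  simp [Finset.sum_apply, unitVec]

theorem simplexM_eq (d m : ℕ) :
    simplexM d m = ((d / 2 + 1) * m + 1) * (d - d / 2 + 1) := by
  rw [simplexM, Nat.ceilDiv_eq_add_pred_div, Nat.ceilDiv_eq_add_pred_div,
    show (d + 1 + 2 - 1) / 2 = d / 2 + 1 by omega,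
    show (d + 2 + 2 - 1) / 2 = d - d / 2 + 1 by omega]

/-- Both parities of d are covered at once, since ⌈(d + 2)/2⌉ = d - ⌊d/2⌋ + 1. -/
theorem simplexVertexReal_eq_hermiteVertex (e m : ℕ) :
    simplexVertexReal (e + 1) m = hermiteVertex (simplexM (e + 1) m)
      (blockWeight e ((e + 1) / 2) (e + 1 - (e + 1) / 2 + 1) m) := by
  have hq : (e + 1 + 2) ⌈/⌉ 2 = e + 1 - (e + 1) / 2 + 1 := by
    rw [Nat.ceilDiv_eq_add_pred_div]; omega
  funext i
  refine Fin.cases ?_ (fun j => ?_) i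
  · ext k
    simp [simplexVertexReal, simplexVertex, hermiteVertex]
  · refine Fin.lastCases ?_ (fun l => ?_) j
    · ext k
      simp only [simplexVertexReal, simplexVertex, hermiteVertex, Fin.cons_succ, Fin.snoc_last,
        Fin.val_succ, Fin.val_last, Nat.succ_ne_zero, lt_irrefl, if_false, Pi.add_apply,
        Pi.smul_apply, sum_unitVec_apply, Finset.mem_Icc, hq, unitVec, smul_eq_mul]
      refine Fin.lastCases ?_ (fun k => ?_) k
      · rw [if_neg, if_neg, if_pos] <;> simp
        omega
      · have hk := k.2
        simp only [Fin.snoc_castSucc, Fin.val_castSucc, blockWeight]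
        by_cases h : (k : ℕ) < (e + 1) / 2
        · rw [if_pos (by omega), if_neg (by omega), if_neg (by omega), if_pos h]
          push_cast
          ring
        · rw [if_neg (by omega), if_pos (by omega), if_neg (by omega), if_neg h]
          push_cast
          ring
    · ext k
      have hl := l.2
      simp [simplexVertexReal, simplexVertex, hermiteVertex, unitVec, Pi.single_apply, Fin.ext_iff]

theorem simplexM_pos (d m : ℕ) : 0 < simplexM d m := by
  rw [simplexM_eq]; positivity

theorem affineIndependent_simplexVertexReal {d : ℕ} (hd : 1 ≤ d) (m : ℕ) :
    AffineIndependent ℝ (simplexVertexReal d m) := by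
  obtain ⟨e, rfl⟩ := Nat.exists_eq_add_of_le' hd
  rw [simplexVertexReal_eq_hermiteVertex]
  exact affineIndependent_hermiteVertex _ _ (simplexM_pos _ _)

/-- The `δ`-vector of `P(d, m)`, uniformly in the parity of `d`. -/
theorem deltaVector_latticeSimplex {d m : ℕ} (hd : 1 ≤ d) (hm : 1 ≤ m) (i : ℕ) :
    deltaVector (latticeSimplex d m) i =
      ((if i ≤ d - d / 2 then i * m + 1 else 0) +
        (if d - d / 2 ≤ i then (d + 1 - i) * m else 0) : ℕ) := by
  obtain ⟨e, rfl⟩ := Nat.exists_eq_add_of_le' hd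
  rw [latticeSimplex, simplexVertexReal_eq_hermiteVertex,
    deltaVector_hermiteSimplex _ _ (simplexM_pos _ _), simplexM_eq]
  have := sum_boxHeight_blockWeight_eq (e := e) (h := (e + 1) / 2) (q := e + 1 - (e + 1) / 2 + 1)
    (c := (e + 1) / 2 + 1) (by omega) rfl (by omega) (by omega) (by omega) hm i
  rw [show (e + 1) / 2 + 1 + (e + 1 - (e + 1) / 2 + 1) - 1 - i = e + 1 + 1 - i by omega] at this
  simp only [Nat.lt_succ_iff, Nat.add_le_add_iff_right] at this
  rw [← this]
  push_cast
  rfl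

/-! ### The entries of the δ-vector and their inequalities. -/

theorem deltaVector_latticeSimplex_of_lt {d m i : ℕ} (hd : 1 ≤ d) (hm : 1 ≤ m)
    (hi : i < d - d / 2) : deltaVector (latticeSimplex d m) i = (i : ℤ) * m + 1 := by
  rw [deltaVector_latticeSimplex hd hm, if_pos hi.le, if_neg (by omega)]
  push_cast; ring

theorem deltaVector_latticeSimplex_middle {d m : ℕ} (hd : 1 ≤ d) (hm : 1 ≤ m) :
    deltaVector (latticeSimplex d m) (d - d / 2) = ((d : ℤ) + 1) * m + 1 := by
  rw [deltaVector_latticeSimplex hd hm, if_pos le_rfl, if_pos le_rfl]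
  have : ((d + 1 : ℕ) : ℤ) = ((d - d / 2 : ℕ) : ℤ) + ((d + 1 - (d - d / 2) : ℕ) : ℤ) := by omega
  push_cast at this ⊢
  rw [this]; ring

theorem deltaVector_latticeSimplex_of_gt {d m i : ℕ} (hd : 1 ≤ d) (hm : 1 ≤ m)
    (hi : d - d / 2 < i) (hi' : i ≤ d + 1) :
    deltaVector (latticeSimplex d m) i = ((d : ℤ) + 1 - i) * m := by
  rw [deltaVector_latticeSimplex hd hm, if_neg (by omega), if_pos hi.le]
  push_cast [Nat.cast_sub hi']; ring

theorem isAlternatinglyIncreasing_deltaVector_latticeSimplex {d m : ℕ} (hd : 1 ≤ d) (hm : 1 ≤ m) :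
    IsAlternatinglyIncreasing d (deltaVector (latticeSimplex d m)) := by
  have hm' : (1 : ℤ) ≤ m := by exact_mod_cast hm
  refine ⟨fun i hi => ?_, fun i hi hi' => ?_⟩
  · rcases (show i ≤ d - d / 2 - 1 ∨ d - d / 2 ≤ i by omega) with h | h
    · rw [deltaVector_latticeSimplex_of_lt hd hm (by omega)]
      rcases (show d - d / 2 < d - i ∨ d - i = d - d / 2 by omega) with h' | h'
      · rw [deltaVector_latticeSimplex_of_gt hd hm h' (by omega), Nat.cast_sub (by omega)]
        nlinarith
      · rw [h', deltaVector_latticeSimplex_middle hd hm]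
        have : (i : ℤ) ≤ d + 1 := by omega
        nlinarith
    · omega
  · rw [deltaVector_latticeSimplex_of_gt hd hm (by omega) (by omega), Nat.cast_sub (by omega)]
    push_cast
    rcases (show i < d - d / 2 ∨ i = d - d / 2 by omega) with h | h
    · rw [deltaVector_latticeSimplex_of_lt hd hm h]
      nlinarith
    · have : (i : ℤ) ≤ d + 1 := by omega
      have hmid := deltaVector_latticeSimplex_middle hd hm
      rw [← h] at hmid
      rw [hmid]
      nlinarith

/-- Log-concavity fails just after the peak. With ⌊d/2⌋ = b + 2, the entries there are (d + 1)m + 1,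
(b + 2)m, (b + 1)m, and (b + 2)² ≤ (d + 1)(b + 1) because d ≥ 2b + 4; the extra 1 in the peak makes
the violation strict. -/
theorem not_isLogConcaveSeq_deltaVector_latticeSimplex {d m : ℕ} (hd : 4 ≤ d) (hm : 1 ≤ m) :
    ¬ IsLogConcaveSeq d (deltaVector (latticeSimplex d m)) := by
  intro h
  have h1 := h (d - d / 2 + 1) (by omega) (by omega)
  rw [Nat.add_sub_cancel, deltaVector_latticeSimplex_middle (by omega) hm,
    deltaVector_latticeSimplex_of_gt (by omega) hm (by omega) (by omega),
    deltaVector_latticeSimplex_of_gt (by omega) hm (by omega) (by omega)] at h1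
  have hm' : (1 : ℤ) ≤ m := by exact_mod_cast hm
  obtain ⟨b, hb⟩ : ∃ b : ℕ, d / 2 = b + 2 := ⟨d / 2 - 2, by omega⟩
  have e1 : (d : ℤ) + 1 - ((d - d / 2 + 1 : ℕ) : ℤ) = b + 2 := by omega
  have e2 : (d : ℤ) + 1 - ((d - d / 2 + 1 + 1 : ℕ) : ℤ) = b + 1 := by omega
  rw [e1, e2] at h1
  have hd' : 2 * (b : ℤ) + 4 ≤ d := by omega
  have hb0 : (0 : ℤ) ≤ b := Int.natCast_nonneg b
  have h2 : ((b : ℤ) + 2) ^ 2 ≤ (d + 1) * (b + 1) := by nlinarith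
  have h3 := mul_le_mul_of_nonneg_right h2 (sq_nonneg (m : ℤ))
  have h4 : 0 < ((b : ℤ) + 1) * m := by positivity
  nlinarith

theorem mainTheorem4 (d m : ℕ) (hd : 4 ≤ d) (hm : 1 ≤ m) :
    -- `P(d, m)` is a simplex of dimension `d`
    AffineIndependent ℝ (simplexVertexReal d m) ∧
    polytopeDim (latticeSimplex d m) = d ∧
    -- its `δ`-vector is concentrated in degrees `0, …, d`
    (∀ i : ℕ, d < i → deltaVector (latticeSimplex d m) i = 0) ∧
    -- the `δ`-vector for odd `d`, with `d' = (d + 1) / 2`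
    (∀ d' : ℕ, d + 1 = 2 * d' →
      (∀ i : ℕ, i ≤ d' - 1 → deltaVector (latticeSimplex d m) i = (i : ℤ) * m + 1) ∧
      deltaVector (latticeSimplex d m) d' = 2 * (d' : ℤ) * m + 1 ∧
      (∀ i : ℕ, d' + 1 ≤ i → i ≤ d →
        deltaVector (latticeSimplex d m) i = ((d : ℤ) + 1 - i) * m)) ∧
    -- the `δ`-vector for even `d`, with `d' = d / 2`
    (∀ d' : ℕ, d = 2 * d' →
      (∀ i : ℕ, i ≤ d' - 1 → deltaVector (latticeSimplex d m) i = (i : ℤ) * m + 1) ∧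
      deltaVector (latticeSimplex d m) d' = (2 * (d' : ℤ) + 1) * m + 1 ∧
      (∀ i : ℕ, d' + 1 ≤ i → i ≤ d →
        deltaVector (latticeSimplex d m) i = ((d : ℤ) + 1 - i) * m)) ∧
    IsAlternatinglyIncreasing d (deltaVector (latticeSimplex d m)) ∧
    ¬ IsLogConcaveSeq d (deltaVector (latticeSimplex d m)) := by
  have hd1 : 1 ≤ d := by omega
  have hmid := deltaVector_latticeSimplex_middle hd1 hm
  have haff := affineIndependent_simplexVertexReal hd1 m
  refine ⟨haff, polytopeDim_convexHull_range_of_affineIndependent haff, fun i hi => ?_,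
    fun d' hd' => ⟨fun i hi => ?_, ?_, fun i hi hi' => ?_⟩,
    fun d' hd' => ⟨fun i hi => ?_, ?_, fun i hi hi' => ?_⟩,
    isAlternatinglyIncreasing_deltaVector_latticeSimplex hd1 hm,
    not_isLogConcaveSeq_deltaVector_latticeSimplex hd hm⟩
  · rw [deltaVector_latticeSimplex hd1 hm, if_neg (by omega), if_pos (by omega),
      Nat.sub_eq_zero_of_le hi]
    simp
  · exact deltaVector_latticeSimplex_of_lt hd1 hm (by omega)
  · rw [show d - d / 2 = d' by omega] at hmid
    rw [hmid, show (d : ℤ) + 1 = 2 * d' by omega]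
  · exact deltaVector_latticeSimplex_of_gt hd1 hm (by omega) (by omega)
  · exact deltaVector_latticeSimplex_of_lt hd1 hm (by omega)
  · rw [show d - d / 2 = d' by omega] at hmid
    rw [hmid, show (d : ℤ) = 2 * d' by omega]
  · exact deltaVector_latticeSimplex_of_gt hd1 hm (by omega) (by omega)
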